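/- For a finite $p$-group $G$ ($p$ prime), let $\gamma_1(G)=G$ and $\gamma_{j+1}(G)=[\gamma_j(G),G]$ denote the lower central series. Put $X_0(G)=G$; for $1\le i\le \log_p|G|$ let $X_i(G)$ be the intersection of all subgroups of $G$ of index $p^i$; and put $X_i(G)=1$ for $i>\log_p|G|$. Let $p$ be a prime and $i\ge 1$ an integer. Then $$\gamma_{p^{i-1}+1}(G)\le X_i(G)$$ for every finite $p$-group $G$, and the index $p^{i-1}+1$ is optimal: it is the least $j\ge 1$ such that $\gamma_j(G)\le X_i(G)$ for all finite $p$-groups $G$. Moreover, every Sylow $p$-subgroup $L_i$ of the symmetric group $S_{p^i}$ witnesses this: $L_i$ is isomorphic to the $i$-fold iterated wreath product $C_p\wr\cdots\wr C_p$, it satisfies $X_i(L_i)=1$, and $p^{i-1}+1$ is the least $j\ge 1$ such that $\gamma_j(L_i)\le X_i(L_i)$. -/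

import Mathlib

universe u

/-- The lower central series with the usual indexing `γ₁(G) = G`, `γ_{j+1}(G) = [γ_j(G), G]`
(Mathlib's series starts at index `0`). Only indices `j ≥ 1` are meaningful. -/
def lcsTerm (G : Type*) [Group G] (j : ℕ) : Subgroup G :=
  (⊤ : Subgroup G).lowerCentralSeries (j - 1)

open Classical in
/-- The term `X_i(G)` of the X-series of a finite `p`-group `G`: `X_0(G) = G`; for
`1 ≤ i ≤ log_p |G|` it is the intersection of all subgroups of `G` of index `p ^ i`;
and `X_i(G) = 1` for `i > log_p |G|`. -/
noncomputable def xSeries (p : ℕ) (G : Type*) [Group G] (i : ℕ) : Subgroup G :=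
  if i = 0 then ⊤
  else if p ^ i ≤ Nat.card G then sInf {T : Subgroup G | T.index = p ^ i}
  else ⊥

/-!
Let `C` be cyclic of order `p` and let `W n` be the `n`-fold wreath product of `C` with itself. It
is isomorphic to the Sylow `p`-subgroups of the symmetric group on `p ^ n` points, and everything
rests on the fact that `W (n + 1)` has nilpotency class exactly `p ^ n`.

For the upper bound, the induction runs over the lower `p`-central series, `M ↦ [M, G] M ^ p`, which
contains the lower central series. If that of `D` has length `c ≥ 1`, then that of `D ≀ᵣ C` has
length at most `c * p`. Indeed, let `S / N` be a factor of the series of `D`: it is central and of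
exponent `p`. On functions `C → S / N` a commutator with an element of the wreath product acts as a
multiple of the difference operator `σ - 1` of a generator of `C`, and
`(σ - 1) ^ p = σ ^ p - 1 = 0` in characteristic `p`; so `p` steps lead from the functions with values
in `S` to those with values in `N` (`iterate_pCentralStep_baseOf_le`). The quotient `C` at the top
costs no extra step (`pCentralStep_top_le`).

If `T` has index `p ^ (n + 1)` in a finite `p`-group `G`, then the action on `G ⧸ T` maps `G` into a
Sylow subgroup of `Perm (G ⧸ T)`, with kernel inside `T`; hence `γ_(p ^ n + 1)(G) ≤ T`.

For optimality, `C ≀ᵣ C_q` with `q = p ^ n` acts faithfully and transitively on `p ^ (n + 1)` points,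
so every Sylow subgroup `L` of the symmetric group contains a conjugate of it. By transitivity point
stabilizers in `L` have index `p ^ (n + 1)`, and they intersect trivially. Repeatedly commuting a
function supported at one point with a generator of `C_q` widens the support by one point at each
step, so the result is nontrivial after `q - 1` steps (`lowerCentralSeries_ne_bot`), and the class
of `L` is at least `q`.
-/

section

open Subgroup
open scoped commutatorElement

/-! ### The lower `p`-central series -/

section PCentralStep

variable {G : Type*} [Group G]

/-- One step of the lower `p`-central series: the subgroup `[M, G] M ^ p` generated by the
commutators `⁅m, g⁆` and the powers `m ^ p` with `m ∈ M` and `g ∈ G`. It is defined for every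
subgroup `M`, so that it can be compared along arbitrary descending chains. -/
def pCentralStep (p : ℕ) (M : Subgroup G) : Subgroup G :=
  ⁅M, (⊤ : Subgroup G)⁆ ⊔ closure ((· ^ p) '' (M : Set G))

theorem pCentralStep_le_iff {p : ℕ} {M N : Subgroup G} :
    pCentralStep p M ≤ N ↔ (∀ m ∈ M, ∀ g : G, ⁅m, g⁆ ∈ N) ∧ ∀ m ∈ M, m ^ p ∈ N := by
  rw [pCentralStep, sup_le_iff, commutator_le, closure_le]
  refine and_congr ?_ ?_
  · simp
  · simp [Set.subset_def]

theorem commutator_mem_pCentralStep (p : ℕ) {M : Subgroup G} {m : G} (hm : m ∈ M) (g : G) :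
    ⁅m, g⁆ ∈ pCentralStep p M :=
  (pCentralStep_le_iff.1 le_rfl).1 m hm g

theorem pow_mem_pCentralStep (p : ℕ) {M : Subgroup G} {m : G} (hm : m ∈ M) :
    m ^ p ∈ pCentralStep p M :=
  (pCentralStep_le_iff.1 le_rfl).2 m hm

theorem pCentralStep_mono (p : ℕ) : Monotone (pCentralStep p : Subgroup G → Subgroup G) :=
  fun _ _ h => pCentralStep_le_iff.2
    ⟨fun _ hm g => commutator_mem_pCentralStep p (h hm) g,
      fun _ hm => pow_mem_pCentralStep p (h hm)⟩

theorem pCentralStep_le (p : ℕ) (M : Subgroup G) [M.Normal] : pCentralStep p M ≤ M :=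
  pCentralStep_le_iff.2
    ⟨fun _ hm g => commutator_le_left M ⊤ (commutator_mem_commutator hm (mem_top g)),
      fun _ hm => pow_mem hm p⟩

theorem normal_of_commutator_mem {N : Subgroup G} (h : ∀ n ∈ N, ∀ g : G, ⁅n, g⁆ ∈ N) :
    N.Normal := by
  refine ⟨fun n hn g => ?_⟩
  have : g * n * g⁻¹ = ⁅n, g⁆⁻¹ * n := by rw [commutatorElement_def]; group
  rw [this]
  exact mul_mem (inv_mem (h n hn g)) hn

instance pCentralStep_normal (p : ℕ) (M : Subgroup G) [M.Normal] :
    (pCentralStep p M).Normal :=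
  normal_of_commutator_mem fun _ hn g =>
    commutator_mem_pCentralStep p (pCentralStep_le p M hn) g

theorem iterate_pCentralStep_normal (p n : ℕ) :
    ((pCentralStep p)^[n] (⊤ : Subgroup G)).Normal := by
  induction n with
  | zero => exact (inferInstance : (⊤ : Subgroup G).Normal)
  | succ n ih => rw [Function.iterate_succ_apply']; infer_instance

theorem lowerCentralSeries_le_iterate_pCentralStep (p n : ℕ) :
    (⊤ : Subgroup G).lowerCentralSeries n ≤ (pCentralStep p)^[n] ⊤ := by
  induction n with
  | zero => simp
  | succ n ih =>
    rw [Function.iterate_succ_apply', Subgroup.lowerCentralSeries_succ]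
    exact (commutator_mono ih le_rfl).trans le_sup_left

end PCentralStep

/-! ### The lower `p`-central series of a regular wreath product -/

namespace RegularWreathProduct

/-- The inclusion of the base group `Q → D` into the wreath product `D ≀ᵣ Q`. -/
def baseHom (D Q : Type*) [Group D] [Group Q] : (Q → D) →* D ≀ᵣ Q where
  toFun f := ⟨f, 1⟩
  map_one' := rfl
  map_mul' f g := by ext <;> simp

/-- The subgroup of the base group of `D ≀ᵣ Q` formed by the functions with values in `S`. -/
def baseOf {D : Type*} (Q : Type*) [Group D] [Group Q] (S : Subgroup D) : Subgroup (D ≀ᵣ Q) :=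
  (Subgroup.pi Set.univ fun _ => S).map (baseHom D Q)

variable {D Q : Type*} [Group D] [Group Q]

@[simp] theorem baseHom_left (f : Q → D) : (baseHom D Q f).left = f := rfl

@[simp] theorem baseHom_right (f : Q → D) : (baseHom D Q f).right = 1 := rfl

theorem baseHom_mem_baseOf {S : Subgroup D} {f : Q → D} (hf : ∀ x, f x ∈ S) :
    baseHom D Q f ∈ baseOf Q S :=
  mem_map_of_mem _ fun x _ => hf x

theorem mem_baseOf_iff {S : Subgroup D} {w : D ≀ᵣ Q} :
    w ∈ baseOf Q S ↔ ∃ f : Q → D, (∀ x, f x ∈ S) ∧ baseHom D Q f = w := by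
  simp [baseOf, Subgroup.mem_pi]

theorem baseOf_bot : baseOf Q (⊥ : Subgroup D) = ⊥ := by
  refine eq_bot_iff.2 fun w hw => ?_
  obtain ⟨f, hf, rfl⟩ := mem_baseOf_iff.1 hw
  have : f = 1 := funext fun x => by simpa using hf x
  rw [this, map_one]
  exact one_mem _

theorem baseOf_top : baseOf Q (⊤ : Subgroup D) = (rightHom : D ≀ᵣ Q →* Q).ker := by
  ext w
  rw [mem_baseOf_iff, MonoidHom.mem_ker, rightHom_eq_right]
  constructor
  · rintro ⟨f, -, rfl⟩
    rfl
  · intro h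
    exact ⟨w.left, fun _ => mem_top _, by ext <;> simp [h]⟩

theorem baseHom_mul_inl (w : D ≀ᵣ Q) : baseHom D Q w.left * inl w.right = w := by
  ext <;> simp

/-- Modulo `pCentralStep p (baseOf Q ⊤)` the base group is central of exponent `p`. Since its
complement `Q` is abelian of exponent `p`, so is the whole quotient. -/
theorem pCentralStep_top_le (p : ℕ) (hcomm : ∀ a b : Q, a * b = b * a) (hexp : ∀ a : Q, a ^ p = 1) :
    pCentralStep p (⊤ : Subgroup (D ≀ᵣ Q)) ≤ pCentralStep p (baseOf Q ⊤) := by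
  have hnormal : (baseOf Q (⊤ : Subgroup D)).Normal := baseOf_top (D := D) (Q := Q) ▸ inferInstance
  set N := pCentralStep p (baseOf Q (⊤ : Subgroup D))
  let π := QuotientGroup.mk' N
  have hπ (w : D ≀ᵣ Q) : w ∈ N ↔ π w = 1 := (QuotientGroup.eq_one_iff w).symm
  -- The base group is central modulo `N`.
  have hbase (f : Q → D) (g : D ≀ᵣ Q) : Commute (π (baseHom D Q f)) (π g) := by
    have h : ⁅baseHom D Q f, g⁆ ∈ N :=
      commutator_mem_pCentralStep p (baseHom_mem_baseOf fun _ => mem_top _) g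
    rw [hπ, map_commutatorElement] at h
    exact commutatorElement_eq_one_iff_commute.1 h
  have hinl (a b : Q) : Commute (π (inl a)) (π (inl b)) := by
    rw [commute_iff_eq, ← map_mul, ← map_mul, ← map_mul, ← map_mul, hcomm]
  refine pCentralStep_le_iff.2 ⟨fun u _ v => ?_, fun u _ => ?_⟩
  · rw [hπ, map_commutatorElement, commutatorElement_eq_one_iff_commute,
      ← baseHom_mul_inl u, map_mul]
    refine (hbase _ _).mul_left ?_
    rw [← baseHom_mul_inl v, map_mul]
    exact (hbase _ _).symm.mul_right (hinl _ _)
  · have h : baseHom D Q u.left ^ p ∈ N :=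
      pow_mem_pCentralStep p (baseHom_mem_baseOf fun _ => mem_top _)
    rw [hπ, map_pow] at h
    rw [hπ, map_pow, ← baseHom_mul_inl u, map_mul, (hbase _ _).mul_pow, h, one_mul,
      ← map_pow, ← map_pow, hexp, map_one, map_one]

/-- The regular action of `Q` on functions `Q → A`, by additive endomorphisms. -/
def translation (Q A : Type*) [Group Q] [AddCommGroup A] : Q →* AddMonoid.End (Q → A) where
  toFun r :=
    { toFun := fun f x => f (r⁻¹ * x)
      map_zero' := rfl
      map_add' := fun _ _ => rfl }
  map_one' := by
    ext f x
    exact congrArg f (by simp)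
  map_mul' r s := by
    ext f x
    exact congrArg f (by simp [mul_assoc])

@[simp] theorem translation_apply {A : Type*} [AddCommGroup A] (r : Q) (f : Q → A) (x : Q) :
    translation Q A r f x = f (r⁻¹ * x) := rfl

/-- This is `(σ - 1) ^ p = σ ^ p - 1` in characteristic `p`, for the translation `σ` by `t`. -/
theorem translation_sub_one_pow {A : Type*} [AddCommGroup A] {p : ℕ} (hp : p.Prime)
    (hA : ∀ a : A, p • a = 0) {t : Q} (ht : t ^ p = 1) :
    (translation Q A t - 1) ^ p = 0 := by
  have hchar : (p : AddMonoid.End (Q → A)) = 0 := by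
    ext f x
    simp [hA]
  obtain ⟨r, hr⟩ := (Commute.one_right (translation Q A t - 1)).exists_add_pow_prime_eq hp
  rw [sub_add_cancel, ← map_pow, ht, map_one, hchar] at hr
  simpa using hr

theorem sub_one_pow_mul_one_sub_pow {R : Type*} [Ring R] (s : R) (e k : ℕ) :
    (s - 1) ^ e * (1 - s ^ k) = -(∑ j ∈ Finset.range k, s ^ j) * (s - 1) ^ (e + 1) := by
  have hc : Commute (∑ j ∈ Finset.range k, s ^ j) ((s - 1) ^ e) :=
    Commute.sum_left _ _ _ fun j _ =>
      (((Commute.refl s).sub_right (Commute.one_right s)).pow_left j).pow_right e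
  rw [← neg_sub (s ^ k) 1, ← geom_sum_mul, mul_neg, ← mul_assoc, ← hc.eq, mul_assoc, ← pow_succ,
    neg_mul]

/-- If `S / N` is central of exponent `p`, then the functions with values in `S` descend to those
with values in `N` within `p` steps. -/
theorem iterate_pCentralStep_baseOf_le_of_hom {p : ℕ} (hp : p.Prime) {t : Q} (ht : t ^ p = 1)
    (hgen : ∀ r : Q, ∃ k : ℕ, t ^ k = r) {S N : Subgroup D} (hNS : N ≤ S)
    (hcomm : ∀ s ∈ S, ∀ d : D, ⁅s, d⁆ ∈ N)
    {A : Type*} [AddCommGroup A] (hA : ∀ a : A, p • a = 0) (π : S →* Multiplicative A)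
    (hπ : ∀ s : S, π s = 1 ↔ (s : D) ∈ N) :
    (pCentralStep p)^[p] (baseOf Q S) ≤ baseOf Q N := by
  -- Let `Ψ` reduce an `S`-valued function modulo `N`, and let `K e` consist of those functions
  -- whose reduction is killed by the `e`-th power of the difference operator `Δ`.
  let Ψ : (Q → S) →* Multiplicative (Q → A) :=
    { toFun := fun F => Multiplicative.ofAdd fun x => (π (F x)).toAdd
      map_one' := by ext; simp
      map_mul' := fun F F' => by ext; simp }
  let ι : (Q → S) →* D ≀ᵣ Q := (baseHom D Q).comp (S.subtype.compLeft Q)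
  let Δ : AddMonoid.End (Q → A) := translation Q A t - 1
  let K : ℕ → Subgroup (D ≀ᵣ Q) := fun e =>
    (((AddMonoidHom.toMultiplicative (Δ ^ e)).comp Ψ).ker).map ι
  have hK (e : ℕ) (w : D ≀ᵣ Q) :
      w ∈ K e ↔ ∃ F : Q → S, (Δ ^ e) (Ψ F).toAdd = 0 ∧ ι F = w := Iff.rfl
  have hstep (e : ℕ) : pCentralStep p (K (e + 1)) ≤ K e := by
    refine pCentralStep_le_iff.2 ⟨fun w hw g => ?_, fun w hw => ?_⟩
    · obtain ⟨F, hF, rfl⟩ := (hK _ _).1 hw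
      refine (hK _ _).2 ⟨fun x => F x * (F (g.right⁻¹ * x))⁻¹ *
        ⟨⁅(F (g.right⁻¹ * x) : D), g.left x⁆, hNS (hcomm _ (F _).2 _)⟩, ?_, ?_⟩
      · obtain ⟨k, hk⟩ := hgen g.right
        have hΨ : (Ψ fun x => F x * (F (g.right⁻¹ * x))⁻¹ *
            ⟨⁅(F (g.right⁻¹ * x) : D), g.left x⁆, hNS (hcomm _ (F _).2 _)⟩).toAdd =
            (1 - translation Q A g.right) (Ψ F).toAdd := by
          funext x
          have h1 : π ⟨⁅(F (g.right⁻¹ * x) : D), g.left x⁆, hNS (hcomm _ (F _).2 _)⟩ = 1 :=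
            (hπ _).2 (hcomm _ (F _).2 _)
          change _ = (Ψ F).toAdd x - (Ψ F).toAdd (g.right⁻¹ * x)
          simp [Ψ, h1, sub_eq_add_neg]
        -- `1 - σ ^ k` is a multiple of `Δ = σ - 1`, so it raises the power of `Δ` by one.
        have hfac : (Δ ^ e * (1 - translation Q A g.right)) =
            -(∑ j ∈ Finset.range k, translation Q A t ^ j) * Δ ^ (e + 1) := by
          rw [← hk, map_pow]
          exact sub_one_pow_mul_one_sub_pow _ e k
        rw [hΨ]
        change (Δ ^ e * (1 - translation Q A g.right)) _ = 0
        rw [hfac]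
        change (-∑ j ∈ Finset.range k, translation Q A t ^ j) ((Δ ^ (e + 1)) _) = 0
        rw [hF, map_zero]
      · ext x
        · simp [ι, commutatorElement_def, mul_assoc]
        · simp [ι, commutatorElement_def]
    · obtain ⟨F, hF, rfl⟩ := (hK _ _).1 hw
      refine (hK _ _).2 ⟨F ^ p, ?_, map_pow _ _ _⟩
      have : (Ψ (F ^ p)).toAdd = 0 := by
        funext x
        simp [Ψ, hA]
      rw [this, map_zero]
  have hiter (j e : ℕ) : (pCentralStep p)^[j] (K (e + j)) ≤ K e := by
    induction j generalizing e with
    | zero => simp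
    | succ j ih =>
      rw [Function.iterate_succ_apply']
      refine (pCentralStep_mono p ?_).trans (hstep e)
      have := ih (e + 1)
      rwa [add_assoc, add_comm 1 j] at this
  have htop : baseOf Q S ≤ K (0 + p) := by
    intro w hw
    obtain ⟨f, hf, rfl⟩ := mem_baseOf_iff.1 hw
    refine (hK _ _).2 ⟨fun x => ⟨f x, hf x⟩, ?_, rfl⟩
    rw [zero_add, translation_sub_one_pow hp hA ht]
    rfl
  have hbot : K 0 ≤ baseOf Q N := by
    intro w hw
    obtain ⟨F, hF, rfl⟩ := (hK _ _).1 hw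
    refine baseHom_mem_baseOf fun x => (hπ _).1 ?_
    have := congrFun (by simpa using hF : (Ψ F).toAdd = 0) x
    simpa [Ψ] using this
  exact ((pCentralStep_mono p).iterate p htop).trans ((hiter p 0).trans hbot)

theorem iterate_pCentralStep_baseOf_le {p : ℕ} (hp : p.Prime) {t : Q} (ht : t ^ p = 1)
    (hgen : ∀ r : Q, ∃ k : ℕ, t ^ k = r) (S : Subgroup D) [S.Normal] :
    (pCentralStep p)^[p] (baseOf Q S) ≤ baseOf Q (pCentralStep p S) := by
  set N := pCentralStep p S with hN
  have hcomm : ∀ s ∈ S, ∀ d : D, ⁅s, d⁆ ∈ N := fun s hs d => commutator_mem_pCentralStep p hs d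
  let _ : CommGroup (S ⧸ N.subgroupOf S) :=
    { mul_comm := by
        rintro ⟨a⟩ ⟨b⟩
        refine QuotientGroup.eq.2 ?_
        rw [mem_subgroupOf]
        have h := hcomm (b : D)⁻¹ (inv_mem b.2) (a : D)⁻¹
        simpa [commutatorElement_def, mul_assoc] using h }
  refine iterate_pCentralStep_baseOf_le_of_hom hp ht hgen (pCentralStep_le p S) hcomm
    (A := Additive (S ⧸ N.subgroupOf S)) ?_ (QuotientGroup.mk' (N.subgroupOf S)) ?_
  · rintro ⟨s⟩
    exact (QuotientGroup.eq_one_iff (s ^ p)).2 (mem_subgroupOf.2 (pow_mem_pCentralStep p s.2))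
  · intro s
    exact (QuotientGroup.eq_one_iff s).trans mem_subgroupOf

/-- Passing from `D` to `D ≀ᵣ Q`, with `Q` cyclic of order `p`, multiplies the length of the lower
`p`-central series by at most `p`. -/
theorem iterate_pCentralStep_eq_bot {p : ℕ} (hp : p.Prime) {t : Q} (ht : t ^ p = 1)
    (hgen : ∀ r : Q, ∃ k : ℕ, t ^ k = r) {c : ℕ} (hc : c ≠ 0)
    (hD : (pCentralStep p)^[c] (⊤ : Subgroup D) = ⊥) :
    (pCentralStep p)^[c * p] (⊤ : Subgroup (D ≀ᵣ Q)) = ⊥ := by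
  have hQ : ∀ a b : Q, a * b = b * a := fun a b => by
    obtain ⟨k, rfl⟩ := hgen a
    obtain ⟨l, rfl⟩ := hgen b
    rw [← pow_add, ← pow_add, add_comm]
  have hexp : ∀ a : Q, a ^ p = 1 := fun a => by
    obtain ⟨k, rfl⟩ := hgen a
    rw [← pow_mul, mul_comm, pow_mul, ht, one_pow]
  have hblock (n : ℕ) : (pCentralStep p)^[n * p] (baseOf Q (⊤ : Subgroup D)) ≤
      baseOf Q ((pCentralStep p)^[n] ⊤) := by
    induction n with
    | zero => simp
    | succ n ih =>
      have := iterate_pCentralStep_normal (G := D) p n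
      rw [add_mul, one_mul, add_comm, Function.iterate_add_apply, Function.iterate_succ_apply']
      exact ((pCentralStep_mono p).iterate p ih).trans
        (iterate_pCentralStep_baseOf_le hp ht hgen _)
  obtain ⟨k, hk⟩ := Nat.exists_eq_succ_of_ne_zero (mul_ne_zero hc hp.ne_zero)
  have htop : (pCentralStep p)^[c * p] (⊤ : Subgroup (D ≀ᵣ Q)) ≤
      (pCentralStep p)^[c * p] (baseOf Q ⊤) := by
    rw [hk, Function.iterate_succ_apply, Function.iterate_succ_apply]
    exact (pCentralStep_mono p).iterate k (pCentralStep_top_le p hQ hexp)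
  rw [eq_bot_iff, ← baseOf_bot (D := D) (Q := Q), ← hD]
  exact htop.trans (hblock c)

end RegularWreathProduct

theorem exists_ofAdd_natCast_pow (q : ℕ) [NeZero q] (r : Multiplicative (ZMod q)) :
    ∃ k : ℕ, Multiplicative.ofAdd (1 : ZMod q) ^ k = r :=
  ⟨r.toAdd.val, by rw [← ofAdd_nsmul]; simp⟩

theorem IteratedWreathProduct.iterate_pCentralStep_eq_bot (p : ℕ) [hp : Fact p.Prime] (n : ℕ) :
    (pCentralStep p)^[p ^ n]
      (⊤ : Subgroup (IteratedWreathProduct (Multiplicative (ZMod p)) (n + 1))) = ⊥ := by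
  have ht : Multiplicative.ofAdd (1 : ZMod p) ^ p = 1 := by rw [← ofAdd_nsmul]; simp
  have hgen := exists_ofAdd_natCast_pow p
  induction n with
  | zero =>
    -- A wreath product with trivial base group: the general length estimate does not apply.
    have hexp : ∀ a : Multiplicative (ZMod p), a ^ p = 1 := fun a => by
      rw [← ofAdd_toAdd a, ← ofAdd_nsmul]; simp
    have h := RegularWreathProduct.pCentralStep_top_le (D := PUnit) p
      (fun a b : Multiplicative (ZMod p) => mul_comm a b) hexp
    rw [Subsingleton.elim (⊤ : Subgroup PUnit) ⊥, RegularWreathProduct.baseOf_bot] at h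
    exact eq_bot_iff.2 (h.trans (pCentralStep_le p ⊥))
  | succ n ih =>
    rw [pow_succ]
    exact RegularWreathProduct.iterate_pCentralStep_eq_bot hp.out ht hgen
      (pow_ne_zero _ hp.out.ne_zero) ih

/-! ### Consequences for `p`-groups of permutations -/

theorem lowerCentralSeries_eq_bot_of_injective {G G' : Type*} [Group G] [Group G'] {f : G →* G'}
    (hf : Function.Injective f) {n : ℕ} (h : (⊤ : Subgroup G').lowerCentralSeries n = ⊥) :
    (⊤ : Subgroup G).lowerCentralSeries n = ⊥ := by
  rw [← map_eq_bot_iff_of_injective _ hf, map_lowerCentralSeries, eq_bot_iff, ← h]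
  exact lowerCentralSeries_mono n le_top

/-- The order of a Sylow `p`-subgroup forces it to be an iterated wreath product, whose class is
bounded through its lower `p`-central series. -/
theorem IsPGroup.lowerCentralSeries_perm_eq_bot {p : ℕ} [hp : Fact p.Prime] {α : Type*} [Finite α]
    {n : ℕ} (hα : Nat.card α = p ^ (n + 1)) {S : Subgroup (Equiv.Perm α)} (hS : IsPGroup p S) :
    S.lowerCentralSeries (p ^ n) = ⊥ := by
  obtain ⟨L, hL⟩ := hS.exists_le_sylow
  have hL' : (⊤ : Subgroup L).lowerCentralSeries (p ^ n) = ⊥ := by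
    let e := Sylow.mulEquivIteratedWreathProduct p (n + 1) α hα (Multiplicative (ZMod p))
      (by simp) L
    refine lowerCentralSeries_eq_bot_of_injective (f := e.toMonoidHom) e.injective ?_
    rw [eq_bot_iff, ← IteratedWreathProduct.iterate_pCentralStep_eq_bot p n]
    exact lowerCentralSeries_le_iterate_pCentralStep p _
  rw [eq_bot_iff]
  refine (lowerCentralSeries_mono _ hL).trans ?_
  change (L : Subgroup (Equiv.Perm α)).lowerCentralSeries (p ^ n) ≤ ⊥
  rw [← top_subtype_lowerCentralSeries, hL', Subgroup.map_bot]

/-- The action of `G` on the cosets of `T` bounds the lower central series modulo the core of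
`T`. -/
theorem IsPGroup.lowerCentralSeries_le_of_index {p : ℕ} [hp : Fact p.Prime] {G : Type*} [Group G]
    [Finite G] (hG : IsPGroup p G) {T : Subgroup G} {m n : ℕ} (hT : T.index = p ^ m)
    (hm : m ≤ n + 1) : (⊤ : Subgroup G).lowerCentralSeries (p ^ n) ≤ T := by
  rcases m with _ | m
  · rw [pow_zero, index_eq_one] at hT
    rw [hT]
    exact le_top
  let φ := MulAction.toPermHom G (G ⧸ T)
  have hbot := IsPGroup.lowerCentralSeries_perm_eq_bot (α := G ⧸ T) hT
    (hG.of_surjective φ.rangeRestrict φ.rangeRestrict_surjective)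
  rw [MonoidHom.range_eq_map, ← map_lowerCentralSeries, Subgroup.map_eq_bot_iff,
    ← normalCore_eq_ker] at hbot
  exact (Subgroup.lowerCentralSeries_antitone ⊤
    (Nat.pow_le_pow_right hp.out.pos (by omega))).trans (hbot.trans T.normalCore_le)

theorem IsPGroup.lcsTerm_le_xSeries {p : ℕ} [hp : Fact p.Prime] {G : Type*} [Group G]
    [Finite G] (hG : IsPGroup p G) (n : ℕ) : lcsTerm G (p ^ n + 1) ≤ xSeries p G (n + 1) := by
  rw [lcsTerm, Nat.add_sub_cancel, xSeries, if_neg n.succ_ne_zero]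
  split_ifs with h
  · exact le_sInf fun T hT => hG.lowerCentralSeries_le_of_index hT le_rfl
  · -- In this case the trivial subgroup has index `p ^ m` with `m ≤ n`.
    obtain ⟨m, hm⟩ := IsPGroup.iff_card.1 hG
    rw [hm, not_le] at h
    exact hG.lowerCentralSeries_le_of_index (by rw [index_bot, hm])
      ((Nat.pow_lt_pow_iff_right hp.out.one_lt).1 h).le

/-! ### Transitive faithful actions -/

theorem xSeries_eq_bot_of_isPretransitive {p : ℕ} {G α : Type*} [Group G] [Finite G]
    [MulAction G α] [FaithfulSMul G α] [MulAction.IsPretransitive G α] [Nonempty α] {i : ℕ}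
    (hi : i ≠ 0) (hα : Nat.card α = p ^ i) : xSeries p G i = ⊥ := by
  have hindex (a : α) : (MulAction.stabilizer G a).index = p ^ i := by
    rw [MulAction.index_stabilizer_of_transitive, hα]
  rw [xSeries, if_neg hi]
  split_ifs
  · refine eq_bot_iff.2 fun g hg => ?_
    rw [mem_sInf] at hg
    refine mem_bot.2 (FaithfulSMul.eq_of_smul_eq_smul (α := α) fun a => ?_)
    rw [one_smul]
    exact MulAction.mem_stabilizer_iff.1 (hg _ (hindex a))
  · rfl

/-! ### The wreath product of a group with a cyclic group -/

namespace RegularWreathProduct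

/-- Starting from a function supported at `1`, repeated commutators with the generator of the cyclic
group are iterated differences: after `k < q` steps the value at `1` is unchanged and the support
lies in `{0, …, k}`. -/
theorem exists_mem_lowerCentralSeries {D : Type*} [Group D] {q : ℕ} [NeZero q] (d : D) (k : ℕ)
    (hk : k < q) :
    ∃ f : Multiplicative (ZMod q) → D,
      baseHom D _ f ∈ (⊤ : Subgroup (D ≀ᵣ Multiplicative (ZMod q))).lowerCentralSeries k ∧
      f 1 = d ∧ ∀ j : ℕ, k < j → j < q → f (Multiplicative.ofAdd (j : ZMod q)) = 1 := by
  induction k with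
  | zero =>
    refine ⟨Pi.mulSingle 1 d, mem_top _, by simp, fun j hj hjq => ?_⟩
    refine Pi.mulSingle_eq_of_ne ?_ _
    rw [Ne, ofAdd_eq_one, ZMod.natCast_eq_zero_iff]
    exact Nat.not_dvd_of_pos_of_lt hj hjq
  | succ k ih =>
    obtain ⟨f, hf, h1, hsupp⟩ := ih (by omega)
    let t : Multiplicative (ZMod q) := Multiplicative.ofAdd 1
    have hval (j : ℕ) : t⁻¹ * Multiplicative.ofAdd ((j + 1 : ℕ) : ZMod q) =
        Multiplicative.ofAdd (j : ZMod q) := by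
      rw [inv_mul_eq_iff_eq_mul, ← ofAdd_add, Nat.cast_succ, add_comm]
    refine ⟨fun x => f x * (f (t⁻¹ * x))⁻¹, ?_, ?_, fun j hj hjq => ?_⟩
    · have h : ⁅baseHom D _ f, inl t⁆ ∈
          (⊤ : Subgroup (D ≀ᵣ Multiplicative (ZMod q))).lowerCentralSeries (k + 1) :=
        commutator_mem_commutator hf (mem_top _)
      convert h using 1
      ext x
      · simp [commutatorElement_def]
      · simp [commutatorElement_def]
    · -- The point preceding `1 = t ^ q` is `t ^ (q - 1)`, outside the support.
      have hq : Multiplicative.ofAdd ((q - 1 + 1 : ℕ) : ZMod q) = 1 := by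
        rw [Nat.sub_add_cancel (by omega)]
        simp
      have := hval (q - 1)
      rw [hq] at this
      simp only [this, h1, hsupp (q - 1) (by omega) (by omega), inv_one, mul_one]
    · obtain ⟨j, rfl⟩ := Nat.exists_eq_succ_of_ne_zero (by omega : j ≠ 0)
      simp only [Nat.succ_eq_add_one, hval, hsupp j (by omega) (by omega),
        hsupp (j + 1) (by omega) hjq, inv_one, mul_one]

theorem lowerCentralSeries_ne_bot (D : Type*) [Group D] [Nontrivial D] (q : ℕ) [NeZero q] :
    (⊤ : Subgroup (D ≀ᵣ Multiplicative (ZMod q))).lowerCentralSeries (q - 1) ≠ ⊥ := by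
  intro h
  obtain ⟨d, hd⟩ := exists_ne (1 : D)
  obtain ⟨f, hf, h1, -⟩ := exists_mem_lowerCentralSeries d (q - 1) (Nat.sub_one_lt (NeZero.ne q))
  rw [h, mem_bot] at hf
  exact hd (h1 ▸ congrFun (congrArg RegularWreathProduct.left hf) 1)

instance isPretransitive_prod (D Q Λ : Type*) [Group D] [Group Q] [MulAction D Λ]
    [MulAction.IsPretransitive D Λ] : MulAction.IsPretransitive (D ≀ᵣ Q) (Λ × Q) := by
  refine ⟨fun ⟨a, x⟩ ⟨b, y⟩ => ?_⟩
  obtain ⟨d, rfl⟩ := MulAction.exists_smul_eq D a b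
  exact ⟨⟨fun _ => d, y * x⁻¹⟩, by simp⟩

end RegularWreathProduct

/-! ### The Sylow subgroups of the symmetric group -/

/-- Up to a relabelling of the points, a given Sylow `p`-subgroup of a symmetric group contains a
given permutation action of a finite `p`-group, since all Sylow `p`-subgroups are conjugate. -/
theorem Sylow.exists_equiv_smul_mem {p : ℕ} [Fact p.Prime] {α β K : Type*} [Finite β] [Group K]
    [MulAction K α] (hK : IsPGroup p K) (hcard : Nat.card α = Nat.card β) [Finite α]
    (L : Sylow p (Equiv.Perm β)) :
    ∃ e : α ≃ β, ∀ k : K, e.permCongrHom (MulAction.toPermHom K α k) ∈ L := by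
  obtain ⟨e⟩ := Finite.card_eq.1 hcard
  let φ : K →* Equiv.Perm β := e.permCongrHom.toMonoidHom.comp (MulAction.toPermHom K α)
  obtain ⟨M, hM⟩ := (hK.of_surjective φ.rangeRestrict φ.rangeRestrict_surjective).exists_le_sylow
  obtain ⟨g, rfl⟩ := MulAction.exists_smul_eq (Equiv.Perm β) M L
  refine ⟨e.trans g, fun k => ?_⟩
  have : (e.trans g).permCongrHom (MulAction.toPermHom K α k) = g * φ k * g⁻¹ := by
    ext x
    simp [φ, Equiv.permCongrHom, Equiv.permCongr]
  rw [this]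
  exact Subgroup.smul_mem_pointwise_smul (φ k) (MulAut.conj g) _ (hM ⟨k, rfl⟩)

/-- The Sylow `p`-subgroups of `Perm (Fin (p ^ (n + 1)))` are transitive, and contain a copy of
`C_p ≀ C_(p ^ n)`, whose class is at least `p ^ n`. -/
theorem Sylow.isPretransitive_and_lowerCentralSeries_ne_bot (p : ℕ) [hp : Fact p.Prime] (n : ℕ)
    (L : Sylow p (Equiv.Perm (Fin (p ^ (n + 1))))) :
    MulAction.IsPretransitive L (Fin (p ^ (n + 1))) ∧
      (⊤ : Subgroup L).lowerCentralSeries (p ^ n - 1) ≠ ⊥ := by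
  let C := Multiplicative (ZMod p)
  let Q := Multiplicative (ZMod (p ^ n))
  have : Nontrivial C := inferInstanceAs (Nontrivial (ZMod p))
  have hC : Nat.card C = p := by simp [C]
  have hQ : Nat.card Q = p ^ n := by simp [Q]
  have : Finite C := Nat.finite_of_card_ne_zero (hC ▸ hp.out.ne_zero)
  have : Finite Q := Nat.finite_of_card_ne_zero (hQ ▸ pow_ne_zero _ hp.out.ne_zero)
  have hK : IsPGroup p (C ≀ᵣ Q) := IsPGroup.of_card (n := p ^ n + n) (by
    rw [RegularWreathProduct.card, hC, hQ, pow_add])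
  obtain ⟨e, he⟩ := Sylow.exists_equiv_smul_mem (α := C × Q) hK
    (by rw [Nat.card_prod, hC, hQ, Nat.card_fin, pow_succ']) L
  constructor
  · refine ⟨fun x y => ?_⟩
    obtain ⟨k, hk⟩ := MulAction.exists_smul_eq (C ≀ᵣ Q) (e.symm x) (e.symm y)
    refine ⟨⟨_, he k⟩, ?_⟩
    rw [Equiv.eq_symm_apply] at hk
    exact hk
  · let ψ : C ≀ᵣ Q →* L :=
      (e.permCongrHom.toMonoidHom.comp (MulAction.toPermHom (C ≀ᵣ Q) (C × Q))).codRestrict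
        (L : Subgroup (Equiv.Perm (Fin (p ^ (n + 1))))) he
    have hψ : Function.Injective ψ := fun a b h =>
      MulAction.toPerm_injective (e.permCongrHom.injective (congrArg Subtype.val h))
    intro h
    exact RegularWreathProduct.lowerCentralSeries_ne_bot C (p ^ n)
      (lowerCentralSeries_eq_bot_of_injective hψ h)

theorem le_of_lcsTerm_eq_bot {G : Type*} [Group G] {q j : ℕ} (hj : 1 ≤ j)
    (hG : (⊤ : Subgroup G).lowerCentralSeries (q - 1) ≠ ⊥) (h : lcsTerm G j = ⊥) : q + 1 ≤ j := by
  by_contra! hlt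
  refine hG (eq_bot_iff.2 ?_)
  rw [← h]
  exact Subgroup.lowerCentralSeries_antitone ⊤ (by omega)

end

theorem proposition2p11 (p : ℕ) [hp : Fact p.Prime] (i : ℕ) (hi : 1 ≤ i) :
    -- containment
    (∀ (G : Type u) [Group G] [Finite G], IsPGroup p G →
      lcsTerm G (p ^ (i - 1) + 1) ≤ xSeries p G i) ∧
    -- optimality of the index
    IsLeast {j : ℕ | 1 ≤ j ∧ ∀ (G : Type u) [Group G] [Finite G], IsPGroup p G →
      lcsTerm G j ≤ xSeries p G i} (p ^ (i - 1) + 1) ∧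
    -- optimality is witnessed by every Sylow `p`-subgroup of the symmetric group on `p ^ i` points
    (∀ L : Sylow p (Equiv.Perm (Fin (p ^ i))),
      Nonempty (L ≃* IteratedWreathProduct (Multiplicative (ZMod p)) i) ∧
      xSeries p L i = ⊥ ∧
      IsLeast {j : ℕ | 1 ≤ j ∧ lcsTerm L j ≤ xSeries p L i} (p ^ (i - 1) + 1)) := by
  obtain ⟨n, rfl⟩ := Nat.exists_eq_succ_of_ne_zero (Nat.one_le_iff_ne_zero.1 hi)
  simp only [Nat.succ_eq_add_one, Nat.add_sub_cancel]
  have hne : Nonempty (Fin (p ^ (n + 1))) := ⟨⟨0, pow_pos hp.out.pos _⟩⟩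
  refine ⟨fun G _ _ hG => hG.lcsTerm_le_xSeries n,
    ⟨⟨by omega, fun G _ _ hG => hG.lcsTerm_le_xSeries n⟩, fun j hj => ?_⟩, fun L => ?_⟩
  · let L : Sylow p (Equiv.Perm (Fin (p ^ (n + 1)))) := default
    obtain ⟨htrans, hclass⟩ := L.isPretransitive_and_lowerCentralSeries_ne_bot p n
    -- A copy of the Sylow subgroup in the prescribed universe.
    let e : ULift.{u} L ≃* L := MulEquiv.ulift
    have : FaithfulSMul (ULift.{u} L) (Fin (p ^ (n + 1))) :=
      ⟨fun h => e.injective (FaithfulSMul.eq_of_smul_eq_smul (α := Fin (p ^ (n + 1))) h)⟩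
    have : MulAction.IsPretransitive (ULift.{u} L) (Fin (p ^ (n + 1))) :=
      ⟨fun x y => (htrans.exists_smul_eq x y).imp' e.symm fun _ h => h⟩
    have h := hj.2 (ULift.{u} L) (L.isPGroup'.of_equiv e.symm)
    rw [xSeries_eq_bot_of_isPretransitive (α := Fin (p ^ (n + 1))) n.succ_ne_zero
      (Nat.card_fin _), le_bot_iff] at h
    exact le_of_lcsTerm_eq_bot (G := L) hj.1 hclass
      (lowerCentralSeries_eq_bot_of_injective (f := e.symm.toMonoidHom) e.symm.injective h)
  · obtain ⟨htrans, hclass⟩ := L.isPretransitive_and_lowerCentralSeries_ne_bot p n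
    have hX : xSeries p L (n + 1) = ⊥ :=
      xSeries_eq_bot_of_isPretransitive n.succ_ne_zero (Nat.card_fin _)
    refine ⟨⟨Sylow.mulEquivIteratedWreathProduct p (n + 1) _ (Nat.card_fin _) _ (by simp) L⟩, hX,
      ⟨by omega, L.isPGroup'.lcsTerm_le_xSeries n⟩, fun j hj => ?_⟩
    exact le_of_lcsTerm_eq_bot hj.1 hclass (le_bot_iff.1 (hX ▸ hj.2))
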